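/- Let $G$ be a non-discrete, locally compact (Hausdorff) topological group with identity $e$, and let $\omega$ be a weight on $G$, that is, a Borel function $\omega : G \to [1,\infty)$, bounded on compact sets, with $\omega(e)=1$ and $\omega(uv)\le\omega(u)\omega(v)$ for all $u,v\in G$. Let $M(G,\omega)$ be the unital complex Banach algebra of all regular complex Borel measures $\mu$ on $G$ with $\|\mu\|_\omega := \int_G \omega\,\mathrm{d}|\mu| < \infty$, with convolution $(\mu*\nu)(B)=\int_G \nu(x^{-1}B)\,\mathrm{d}\mu(x)$ as product and the point mass $\delta_e$ as identity. Then the Dales–Żelazko conjecture holds for $M(G,\omega)$: if every maximal left ideal $I$ of $A = M(G,\omega)$ is finitely generated, i.e. of the form $I = A x_1+\cdots+A x_n$ for some $n\in\mathbb{N}$ and $x_1,\ldots,x_n\in A$ (no closure is taken), then $A$ is finite-dimensional over $\mathbb{C}$. -/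

import Mathlib

namespace MeasAlg

open MeasureTheory MeasureTheory.VectorMeasure Set Filter Topology
open scoped ENNReal NNReal

set_option linter.unusedSectionVars false

/-! ### Finite inner regular positive measures -/

section Positive

theorem innerRegular_of_le {X : Type*} [TopologicalSpace X] [T2Space X] [MeasurableSpace X]
    [BorelSpace X] {κ l : Measure X} [IsFiniteMeasure l] [l.InnerRegular] (h : κ ≤ l) :
    κ.InnerRegular := by
  refine ⟨fun U hU r hr => ?_⟩
  obtain ⟨ε, hε, hrε⟩ : ∃ ε : ℝ≥0∞, ε ≠ 0 ∧ r + ε < κ U := by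
    obtain ⟨δ, hδ, h2⟩ := ENNReal.lt_iff_exists_add_pos_lt.1 hr
    exact ⟨δ, by simpa using hδ.ne', h2⟩
  obtain ⟨K, hKU, hK, hlt⟩ := hU.exists_isCompact_sdiff_lt (measure_ne_top l U) hε
  refine ⟨K, hKU, hK, ?_⟩
  have h1 : κ U ≤ κ K + κ (U \ K) := by
    grw [← measure_union_le, union_sdiff_self]
    exact measure_mono subset_union_right
  have h2 : κ U < κ K + ε := by
    have hfin : κ K ≠ ∞ := ne_top_of_le_ne_top (measure_ne_top l K) (h K)
    exact h1.trans_lt ((ENNReal.add_lt_add_iff_left hfin).2 ((h _).trans_lt hlt))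
  have hε' : ε ≠ ∞ := by rintro rfl; simp at hrε
  exact (ENNReal.add_lt_add_iff_right hε').1 (hrε.trans h2)

variable {G : Type*} [Group G] [TopologicalSpace G] [IsTopologicalGroup G]
  [LocallyCompactSpace G] [T2Space G] [MeasurableSpace G] [BorelSpace G]

/-- A compact set moved into an open set stays there under small perturbations. -/
theorem eventually_mul_subset {K U : Set G} (hK : IsCompact K) (hU : IsOpen U) {x : G}
    (h : K ⊆ (x * ·) ⁻¹' U) : ∀ᶠ y in 𝓝 x, K ⊆ (y * ·) ⁻¹' U := by
  have : ∀ᶠ y in 𝓝 x, ∀ k ∈ K, y * k ∈ U := by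
    apply hK.eventually_forall_of_forall_eventually
    intro k hk
    exact (continuous_mul.tendsto (x, k)).eventually (hU.mem_nhds (h hk))
  exact this

theorem measurable_translate (l : Measure G) [IsFiniteMeasure l] [l.InnerRegular] {B : Set G}
    (hB : MeasurableSet B) : Measurable fun x : G => l ((x * ·) ⁻¹' B) := by
  have hm : ∀ x : G, Measurable (x * · : G → G) := fun x => (continuous_const_mul x).measurable
  induction B, hB using MeasurableSet.induction_on_open with
  | isOpen U hU =>
    refine measurable_of_Ioi fun t => IsOpen.measurableSet ?_
    rw [isOpen_iff_mem_nhds]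
    intro x hx
    obtain ⟨K, hKU, hK, hlt⟩ := (hm x hU.measurableSet).exists_lt_isCompact hx
    filter_upwards [eventually_mul_subset hK hU hKU] with y hy
    exact hlt.trans_le (measure_mono hy)
  | compl s hs ih =>
    have : (fun x : G => l ((x * ·) ⁻¹' sᶜ)) = fun x => l univ - l ((x * ·) ⁻¹' s) := by
      funext x
      rw [preimage_compl, measure_compl (hm x hs) (measure_ne_top _ _)]
    rw [this]
    exact measurable_const.sub ih
  | iUnion f hd hf ih =>
    have : (fun x : G => l ((x * ·) ⁻¹' ⋃ i, f i)) = fun x => ∑' i, l ((x * ·) ⁻¹' f i) := by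
      funext x
      rw [preimage_iUnion, measure_iUnion (fun i j hij => (hd hij).preimage _)
        (fun i => hm x (hf i))]
    rw [this]
    exact Measurable.tsum ih

/-- The convolution of two positive measures, as a mixture of translates. -/
noncomputable def posConv (k l : Measure G) : Measure G := k.bind fun x => l.map (x * ·)

theorem measurable_map_translate (l : Measure G) [IsFiniteMeasure l] [l.InnerRegular] :
    Measurable fun x : G => l.map (x * ·) := by
  refine Measure.measurable_of_measurable_coe _ fun s hs => ?_
  simpa only [Measure.map_apply (continuous_const_mul _).measurable hs] using
    measurable_translate l hs

theorem posConv_apply (k l : Measure G) [IsFiniteMeasure l] [l.InnerRegular] {B : Set G}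
    (hB : MeasurableSet B) : posConv k l B = ∫⁻ x, l ((x * ·) ⁻¹' B) ∂k := by
  rw [posConv, Measure.bind_apply hB (measurable_map_translate l).aemeasurable]
  simp only [Measure.map_apply (continuous_const_mul _).measurable hB]

theorem lintegral_posConv (k l : Measure G) [IsFiniteMeasure l] [l.InnerRegular] {f : G → ℝ≥0∞}
    (hf : Measurable f) : ∫⁻ z, f z ∂posConv k l = ∫⁻ x, ∫⁻ y, f (x * y) ∂l ∂k := by
  rw [posConv, Measure.lintegral_bind (measurable_map_translate l).aemeasurable hf.aemeasurable]
  simp only [lintegral_map hf (continuous_const_mul _).measurable]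

theorem isFiniteMeasure_posConv (k l : Measure G) [IsFiniteMeasure k] [IsFiniteMeasure l]
    [l.InnerRegular] : IsFiniteMeasure (posConv k l) := by
  refine ⟨?_⟩
  rw [posConv_apply k l MeasurableSet.univ]
  simp only [preimage_univ, lintegral_const]
  exact ENNReal.mul_lt_top (measure_lt_top _ _) (measure_lt_top _ _)

theorem posConv_exists_compact (k l : Measure G) [IsFiniteMeasure k] [k.InnerRegular]
    [IsFiniteMeasure l] [l.InnerRegular] {U : Set G} (hU : IsOpen U) {r : ℝ≥0∞}
    (hr : r < posConv k l U) : ∃ K ⊆ U, IsCompact K ∧ r < posConv k l K := by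
  have hm : ∀ x : G, Measurable (x * · : G → G) := fun x => (continuous_const_mul x).measurable
  obtain ⟨δ, hδ, hrδ⟩ := ENNReal.lt_iff_exists_add_pos_lt.1 hr
  obtain ⟨ε, hε, hε3⟩ : ∃ ε : ℝ≥0, 0 < ε ∧ ε + ε + ε = δ :=
    ⟨δ / 3, by positivity, by rw [← add_div, ← add_div]; field_simp; ring⟩
  set f : G → ℝ≥0 := fun x => (l ((x * ·) ⁻¹' U)).toNNReal with hf
  have hfc : ∀ x, (f x : ℝ≥0∞) = l ((x * ·) ⁻¹' U) := fun x =>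
    ENNReal.coe_toNNReal (measure_ne_top _ _)
  have hint : ∫⁻ x, f x ∂k = posConv k l U := by
    simp only [hfc, posConv_apply k l hU.measurableSet]
  have := isFiniteMeasure_posConv k l
  obtain ⟨g, hgf, hg, hfg⟩ := exists_upperSemicontinuous_le_lintegral_le (μ := k) f
    (by rw [hint]; exact measure_ne_top _ _) (ε := ε) (by simpa using hε.ne')
  obtain ⟨η, hη, hηε⟩ : ∃ η : ℝ≥0, 0 < η ∧ (η : ℝ≥0∞) * k univ ≤ ε := by
    refine ⟨ε / ((k univ).toNNReal + 1), by positivity, ?_⟩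
    rw [← ENNReal.coe_toNNReal (measure_ne_top k univ)]
    norm_cast
    rw [div_mul_eq_mul_div]
    exact div_le_of_le_mul₀ (by positivity) (by positivity) (by gcongr; simp)
  obtain ⟨θ, hθ, hθε⟩ : ∃ θ : ℝ≥0, 0 < θ ∧ l univ * (θ : ℝ≥0∞) ≤ ε := by
    refine ⟨ε / ((l univ).toNNReal + 1), by positivity, ?_⟩
    rw [← ENNReal.coe_toNNReal (measure_ne_top l univ)]
    norm_cast
    rw [mul_div_assoc', mul_comm]
    exact div_le_of_le_mul₀ (by positivity) (by positivity) (by gcongr; simp)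
  obtain ⟨C, -, hC, hkC⟩ := (MeasurableSet.univ (α := G)).exists_isCompact_sdiff_lt
    (measure_ne_top k univ) (ε := θ) (by simpa using hθ.ne')
  obtain ⟨K, hKU, hK, hgK⟩ : ∃ K ⊆ U, IsCompact K ∧
      ∀ y ∈ C, (g y : ℝ≥0∞) ≤ l ((y * ·) ⁻¹' K) + η := by
    refine hC.induction_on (p := fun S => ∃ K ⊆ U, IsCompact K ∧
      ∀ y ∈ S, (g y : ℝ≥0∞) ≤ l ((y * ·) ⁻¹' K) + η) ?_ ?_ ?_ ?_
    · exact ⟨∅, by simp⟩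
    · rintro s t hst ⟨K, h1, h2, h3⟩
      exact ⟨K, h1, h2, fun y hy => h3 y (hst hy)⟩
    · rintro s t ⟨K, h1, h2, h3⟩ ⟨K', h1', h2', h3'⟩
      refine ⟨K ∪ K', union_subset h1 h1', h2.union h2', ?_⟩
      rintro y (hy | hy)
      · refine (h3 y hy).trans ?_
        gcongr
        exact subset_union_left
      · refine (h3' y hy).trans ?_
        gcongr
        exact subset_union_right
    · intro x _
      obtain ⟨L, hLU, hL, hlt⟩ := (hm x hU.measurableSet).exists_isCompact_lt_add
        (measure_ne_top l _) (ε := η) (by simpa using hη.ne')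
      obtain ⟨V, hV, hVs, hVc⟩ := local_compact_nhds (eventually_mul_subset hL hU hLU)
      have hgx : ∀ᶠ y in 𝓝 x, (g y : ℝ≥0∞) < l L + η := by
        have h0 : g x < (l L).toNNReal + η := by
          rw [← ENNReal.coe_lt_coe, ENNReal.coe_add, ENNReal.coe_toNNReal (measure_ne_top _ _)]
          exact lt_of_le_of_lt ((ENNReal.coe_le_coe.2 (hgf x)).trans (hfc x).le) hlt
        filter_upwards [hg x _ h0] with y hy
        rw [← ENNReal.coe_lt_coe, ENNReal.coe_add,
          ENNReal.coe_toNNReal (measure_ne_top _ _)] at hy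
        exact hy
      refine ⟨V ∩ {y | (g y : ℝ≥0∞) < l L + η}, mem_nhdsWithin_of_mem_nhds
        (inter_mem hV hgx), (fun p : G × G => p.1 * p.2) '' (V ×ˢ L), ?_,
        (hVc.prod hL).image continuous_mul, ?_⟩
      · rintro _ ⟨⟨v, z⟩, ⟨hv, hz⟩, rfl⟩
        exact hVs hv hz
      · rintro y ⟨hy, hy'⟩
        refine hy'.le.trans ?_
        gcongr
        exact fun z hz => ⟨(y, z), ⟨hy, hz⟩, rfl⟩
  refine ⟨K, hKU, hK, ?_⟩
  have hbound : ∀ x, (g x : ℝ≥0∞) ≤ l ((x * ·) ⁻¹' K) + η + Cᶜ.indicator (fun _ => l univ) x := by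
    intro x
    by_cases hx : x ∈ C
    · exact le_add_right (hgK x hx)
    · rw [indicator_of_mem (show x ∈ Cᶜ from hx)]
      refine le_add_left ((ENNReal.coe_le_coe.2 (hgf x)).trans ?_)
      rw [hfc]
      exact measure_mono (subset_univ _)
  have hgint : ∫⁻ x, g x ∂k ≤ posConv k l K + ε + ε := by
    calc ∫⁻ x, g x ∂k ≤ _ := lintegral_mono hbound
      _ = posConv k l K + η * k univ + l univ * k Cᶜ := by
        rw [lintegral_add_right _ (measurable_const.indicator hC.measurableSet.compl),
          lintegral_add_right _ measurable_const, posConv_apply k l hK.measurableSet,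
          lintegral_indicator_const hC.measurableSet.compl, lintegral_const]
      _ ≤ _ := by
        gcongr
        refine le_trans ?_ hθε
        gcongr
        rw [compl_eq_univ_sdiff]
        exact hkC.le
  have hlt : r + δ < posConv k l K + δ := by
    refine hrδ.trans_le ?_
    rw [← hint, ← hε3]
    refine hfg.trans ?_
    grw [hgint]
    push_cast
    simp only [add_assoc, le_refl]
  exact (ENNReal.add_lt_add_iff_right ENNReal.coe_ne_top).1 hlt

theorem innerRegular_posConv (k l : Measure G) [IsFiniteMeasure k] [k.InnerRegular]
    [IsFiniteMeasure l] [l.InnerRegular] : (posConv k l).InnerRegular := by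
  have := isFiniteMeasure_posConv k l
  have h : (posConv k l).InnerRegularWRT IsCompact IsOpen :=
    fun U hU r hr => posConv_exists_compact k l hU hr
  have hw : (posConv k l).WeaklyRegular := Measure.InnerRegularWRT.weaklyRegular_of_finite _
    fun U hU r hr => let ⟨K, h1, h2, h3⟩ := h hU r hr; ⟨K, h1, h2.isClosed, h3⟩
  have : (posConv k l).Regular := { innerRegular := h }
  infer_instance

end Positive

/-! ### Complex measures and their convolution -/

section Complex

/-- A complex measure has finite total variation. -/
theorem isFiniteMeasure_variation {X : Type*} [MeasurableSpace X] (μ : ComplexMeasure X) :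
    IsFiniteMeasure μ.variation := by
  have h : μ.variation ≤
      (ComplexMeasure.re μ).totalVariation + (ComplexMeasure.im μ).totalVariation := by
    refine variation_le_of_forall_enorm_le fun E _ => ?_
    rw [Measure.add_apply]
    grw [← SignedMeasure.enorm_le_totalVariation, ← SignedMeasure.enorm_le_totalVariation]
    have h1 : μ E = ((ComplexMeasure.re μ E : ℝ) : ℂ) +
        ((ComplexMeasure.im μ E : ℝ) : ℂ) * Complex.I := (Complex.re_add_im (μ E)).symm
    rw [h1]
    refine (enorm_add_le _ _).trans (le_of_eq ?_)
    simp [← ofReal_norm]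
  have (s : SignedMeasure X) : IsFiniteMeasure s.totalVariation := by
    unfold SignedMeasure.totalVariation; infer_instance
  exact isFiniteMeasure_of_le _ h

/-- The integral `∫ f dμ` of a complex function against a complex measure. -/
noncomputable def cint {X : Type*} [MeasurableSpace X] (μ : ComplexMeasure X) (f : X → ℂ) : ℂ :=
  ∫ᵛ x, f x ∂[ContinuousLinearMap.mul ℝ ℂ; μ]

section General

variable {X : Type*} [MeasurableSpace X]

theorem integrable_of_bounded (μ : ComplexMeasure X) {f : X → ℂ} (hf : Measurable f) {c : ℝ}
    (hc : ∀ x, ‖f x‖ ≤ c) : μ.Integrable f := by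
  have := isFiniteMeasure_variation μ
  exact Integrable.of_bound (μ := μ.variation) hf.aestronglyMeasurable c (Eventually.of_forall hc)

theorem enorm_cint_le (μ : ComplexMeasure X) (f : X → ℂ) :
    ‖cint μ f‖ₑ ≤ ∫⁻ x, ‖f x‖ₑ ∂μ.variation := by
  refine (VectorMeasure.enorm_integral_le_lintegral_enorm).trans ?_
  have : ‖ContinuousLinearMap.mul ℝ ℂ‖ₑ ≤ 1 := by
    rw [← ofReal_norm]
    simp
  exact (mul_le_mul_left this _).trans (one_mul _).le

theorem norm_cint_le (μ : ComplexMeasure X) {f : X → ℂ} {b : ℝ} (hb : ∀ x, ‖f x‖ ≤ b) :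
    ‖cint μ f‖ ≤ b * μ.variation.real univ := by
  have := isFiniteMeasure_variation μ
  refine (VectorMeasure.norm_integral_le_of_norm_le_const (Eventually.of_forall hb)).trans (le_of_eq ?_)
  simp

theorem cint_add (μ : ComplexMeasure X) {f g : X → ℂ} (hf : μ.Integrable f)
    (hg : μ.Integrable g) : cint μ (fun x => f x + g x) = cint μ f + cint μ g :=
  integral_fun_add hf hg

theorem cint_indicator_const (μ : ComplexMeasure X) {B : Set X} (hB : MeasurableSet B) (c : ℂ) :
    cint μ (B.indicator fun _ => c) = c * μ B := by
  have := isFiniteMeasure_variation μ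
  exact VectorMeasure.integral_indicator_const c hB

theorem tendsto_cint (μ : ComplexMeasure X) {ι : Type*} {l : Filter ι} [l.IsCountablyGenerated]
    {F : ι → X → ℂ} {f : X → ℂ} {b : ℝ} (hF : ∀ n, Measurable (F n)) (hb : ∀ n x, ‖F n x‖ ≤ b)
    (h : ∀ x, Tendsto (fun n => F n x) l (𝓝 (f x))) :
    Tendsto (fun n => cint μ (F n)) l (𝓝 (cint μ f)) := by
  have := isFiniteMeasure_variation μ
  exact VectorMeasure.tendsto_integral_filter_of_dominated_convergence (fun _ => b)
    (Eventually.of_forall fun n => (hF n).aestronglyMeasurable)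
    (Eventually.of_forall fun n => Eventually.of_forall (hb n)) (integrable_const _)
    (Eventually.of_forall h)

theorem cint_const_mul (μ : ComplexMeasure X) (c : ℂ) {f : X → ℂ} (hf : μ.Integrable f) :
    cint μ (fun x => c * f x) = c * cint μ f := by
  have h1 := integral_continuousLinearMap_comp (B := ContinuousLinearMap.mul ℝ ℂ)
    (C := ContinuousLinearMap.mul ℝ ℂ c) hf
  have h2 := continuousLinearMap_apply_integral (B := ContinuousLinearMap.mul ℝ ℂ)
    (C := ContinuousLinearMap.mul ℝ ℂ c) hf
  have h3 : (ContinuousLinearMap.compL ℝ ℂ ℂ ℂ (ContinuousLinearMap.mul ℝ ℂ c)) ∘L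
      (ContinuousLinearMap.mul ℝ ℂ) =
      ContinuousLinearMap.mul ℝ ℂ ∘L ContinuousLinearMap.mul ℝ ℂ c := by
    ext
    simp [mul_assoc]
  rw [h3, ← h1] at h2
  exact h2.symm

/-- Induction principle for bounded measurable complex functions. -/
theorem bounded_induction {P : (X → ℂ) → Prop}
    (ind : ∀ (c : ℂ) (B : Set X), MeasurableSet B → P (B.indicator fun _ => c))
    (add : ∀ (f g : X → ℂ) (b : ℝ), Measurable f → Measurable g → (∀ x, ‖f x‖ ≤ b) →
      (∀ x, ‖g x‖ ≤ b) → P f → P g → P fun x => f x + g x)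
    (lim : ∀ (F : ℕ → X → ℂ) (f : X → ℂ) (b : ℝ), (∀ n, Measurable (F n)) →
      (∀ n x, ‖F n x‖ ≤ b) → (∀ x, Tendsto (fun n => F n x) atTop (𝓝 (f x))) →
      (∀ n, P (F n)) → P f)
    {f : X → ℂ} (hf : Measurable f) {b : ℝ} (hb : ∀ x, ‖f x‖ ≤ b) : P f := by
  have hs : ∀ s : SimpleFunc X ℂ, P s := by
    intro s
    induction s using SimpleFunc.induction with
    | const c hs =>
      classical
      rw [SimpleFunc.coe_piecewise, SimpleFunc.coe_const, SimpleFunc.coe_const,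
        Function.const_zero, piecewise_eq_indicator]
      exact ind c _ hs
    | @add f g _ hf hg =>
      obtain ⟨b, hb⟩ := f.exists_forall_norm_le
      obtain ⟨c, hc⟩ := g.exists_forall_norm_le
      exact add f g (max b c) f.measurable g.measurable (fun x => (hb x).trans (le_max_left _ _))
        (fun x => (hc x).trans (le_max_right _ _)) hf hg
  rcases isEmpty_or_nonempty X with hX | ⟨⟨x⟩⟩
  · have : f = (0 : SimpleFunc X ℂ) := Subsingleton.elim _ _
    rw [this]
    exact hs 0
  have hb0 : 0 ≤ b := (norm_nonneg _).trans (hb x)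
  exact lim (fun n => hf.stronglyMeasurable.approxBounded b n) f b
    (fun n => SimpleFunc.measurable _)
    (fun n x => hf.stronglyMeasurable.norm_approxBounded_le hb0 n x)
    (fun x => hf.stronglyMeasurable.tendsto_approxBounded_of_norm_le (hb x)) fun n => hs _

theorem cint_smul_measure (c : ℂ) (μ : ComplexMeasure X) {f : X → ℂ} (hf : Measurable f) {b : ℝ}
    (hb : ∀ x, ‖f x‖ ≤ b) : cint (c • μ) f = c * cint μ f := by
  refine bounded_induction (P := fun f => cint (c • μ) f = c * cint μ f) ?_ ?_ ?_ hf hb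
  · intro d B hB
    rw [cint_indicator_const _ hB, cint_indicator_const _ hB, _root_.smul_apply, smul_eq_mul]
    ring
  · intro f g b hf hg hfb hgb h1 h2
    rw [cint_add _ (integrable_of_bounded _ hf hfb) (integrable_of_bounded _ hg hgb),
      cint_add _ (integrable_of_bounded _ hf hfb) (integrable_of_bounded _ hg hgb), h1, h2]
    ring
  · intro F f b hF hb h hP
    refine tendsto_nhds_unique (tendsto_cint (c • μ) hF hb h) ?_
    simp only [hP]
    exact (tendsto_cint μ hF hb h).const_mul c

end General

variable {G : Type*} [Group G] [TopologicalSpace G] [IsTopologicalGroup G]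
  [LocallyCompactSpace G] [T2Space G] [MeasurableSpace G] [BorelSpace G]

theorem innerRegular_variation {μ : ComplexMeasure G} (hμ : μ.variation.Regular) :
    μ.variation.InnerRegular := by
  have := isFiniteMeasure_variation μ
  infer_instance

theorem regular_of_le {μ : ComplexMeasure G} {l : Measure G} [IsFiniteMeasure l] [l.InnerRegular]
    (h : μ.variation ≤ l) : μ.variation.Regular := by
  have := innerRegular_of_le h
  have := isFiniteMeasure_variation μ
  infer_instance

theorem measurable_translate_real {s : SignedMeasure G} {l : Measure G} [IsFiniteMeasure l]
    [l.InnerRegular] (h : ∀ E, ‖s E‖ₑ ≤ l E) {B : Set G}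
    (hB : MeasurableSet B) : Measurable fun x : G => s ((x * ·) ⁻¹' B) := by
  have htv : s.totalVariation ≤ l := by
    rw [SignedMeasure.totalVariation_eq_variation]
    exact variation_le_of_forall_enorm_le fun E _ => h E
  have h1 := innerRegular_of_le (le_trans (Measure.le_add_right le_rfl) htv :
    s.toJordanDecomposition.posPart ≤ l)
  have h2 := innerRegular_of_le (le_trans (Measure.le_add_left le_rfl) htv :
    s.toJordanDecomposition.negPart ≤ l)
  have : (fun x : G => s ((x * ·) ⁻¹' B)) =
      fun x => (s.toJordanDecomposition.posPart ((x * ·) ⁻¹' B)).toReal -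
        (s.toJordanDecomposition.negPart ((x * ·) ⁻¹' B)).toReal := by
    funext x
    exact s.apply_eq_posPart_real_sub_negPart_real ((continuous_const_mul x).measurable hB)
  rw [this]
  exact (measurable_translate _ hB).ennreal_toReal.sub (measurable_translate _ hB).ennreal_toReal

theorem measurable_translate_complex {ν : ComplexMeasure G} (hν : ν.variation.Regular) {B : Set G}
    (hB : MeasurableSet B) : Measurable fun x : G => ν ((x * ·) ⁻¹' B) := by
  have := isFiniteMeasure_variation ν
  have := innerRegular_variation hν
  have hr : ∀ E, ‖(ν E).re‖ₑ ≤ ν.variation E := fun E => by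
    refine le_trans ?_ (enorm_measure_le_variation ν E)
    rw [← ofReal_norm, ← ofReal_norm]
    exact ENNReal.ofReal_le_ofReal (Complex.abs_re_le_norm (ν E))
  have hi : ∀ E, ‖(ν E).im‖ₑ ≤ ν.variation E := fun E => by
    refine le_trans ?_ (enorm_measure_le_variation ν E)
    rw [← ofReal_norm, ← ofReal_norm]
    exact ENNReal.ofReal_le_ofReal (Complex.abs_im_le_norm (ν E))
  have hre := measurable_translate_real (s := ComplexMeasure.re ν) (l := ν.variation) hr hB
  have him := measurable_translate_real (s := ComplexMeasure.im ν) (l := ν.variation) hi hB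
  have h : (fun x : G => ν ((x * ·) ⁻¹' B)) = fun x =>
      ((ComplexMeasure.re ν ((x * ·) ⁻¹' B) : ℝ) : ℂ) +
        ((ComplexMeasure.im ν ((x * ·) ⁻¹' B) : ℝ) : ℂ) * Complex.I :=
    funext fun x => (Complex.re_add_im _).symm
  rw [h]
  exact (Complex.measurable_ofReal.comp hre).add
    ((Complex.measurable_ofReal.comp him).mul_const Complex.I)

theorem integrable_translate (μ : ComplexMeasure G) {ν : ComplexMeasure G}
    (hν : ν.variation.Regular) {B : Set G} (hB : MeasurableSet B) :
    μ.Integrable fun x => ν ((x * ·) ⁻¹' B) :=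
  integrable_of_bounded μ (measurable_translate_complex hν hB) fun _ => norm_apply_le_bound

open scoped Classical in
/-- The convolution of regular complex Borel measures: `(μ * ν)(B) = ∫ ν(x⁻¹B) dμ(x)`, where
`x⁻¹B = {y | x * y ∈ B}`. -/
noncomputable def conv (μ ν : ComplexMeasure G) (hν : ν.variation.Regular) : ComplexMeasure G where
  measureOf' B := if MeasurableSet B then cint μ fun x => ν ((x * ·) ⁻¹' B) else 0
  empty' := by simp [cint]
  not_measurable' _ h := if_neg h
  m_iUnion' f hf hd := by
    have hm : ∀ x : G, Measurable (x * · : G → G) := fun x => (continuous_const_mul x).measurable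
    simp only [hf, ↓reduceIte, MeasurableSet.iUnion hf, preimage_iUnion, HasSum,
      SummationFilter.unconditional_filter]
    have A (a : Finset ℕ) : ∑ i ∈ a, cint μ (fun x => ν ((x * ·) ⁻¹' f i)) =
        cint μ fun x => ∑ i ∈ a, ν ((x * ·) ⁻¹' f i) :=
      (VectorMeasure.integral_finsetSum _ fun i _ => integrable_translate μ hν (hf i)).symm
    simp_rw [A]
    refine tendsto_cint μ (b := ν.bound) (fun a => Finset.measurable_fun_sum _ fun i _ =>
        measurable_translate_complex hν (hf i)) (fun a x => ?_) fun x => ?_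
    · rw [← VectorMeasure.of_biUnion_finset (fun i _ j _ hij => (hd hij).preimage _)
        fun i _ => hm x (hf i)]
      exact norm_apply_le_bound
    · exact hasSum_of_disjoint_iUnion (fun i => hm x (hf i)) fun i j hij => (hd hij).preimage _

theorem conv_apply (μ ν : ComplexMeasure G) (hν : ν.variation.Regular) {B : Set G}
    (hB : MeasurableSet B) : conv μ ν hν B = cint μ fun x => ν ((x * ·) ⁻¹' B) := if_pos hB

theorem variation_conv_le (μ ν : ComplexMeasure G) (hν : ν.variation.Regular) :
    (conv μ ν hν).variation ≤ posConv μ.variation ν.variation := by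
  have := isFiniteMeasure_variation ν
  have := innerRegular_variation hν
  refine variation_le_of_forall_enorm_le fun E hE => ?_
  rw [conv_apply μ ν hν hE, posConv_apply _ _ hE]
  exact (enorm_cint_le _ _).trans (lintegral_mono fun x => enorm_measure_le_variation _ _)

theorem regular_conv {μ ν : ComplexMeasure G} (hμ : μ.variation.Regular)
    (hν : ν.variation.Regular) : (conv μ ν hν).variation.Regular := by
  have := isFiniteMeasure_variation ν
  have := innerRegular_variation hν
  have := isFiniteMeasure_variation μ
  have := innerRegular_variation hμ
  have := innerRegular_posConv μ.variation ν.variation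
  have := isFiniteMeasure_posConv μ.variation ν.variation
  exact regular_of_le (variation_conv_le μ ν hν)

theorem conv_add (μ ν ρ : ComplexMeasure G) (hν : ν.variation.Regular) (hρ : ρ.variation.Regular)
    (h : (ν + ρ).variation.Regular) : conv μ (ν + ρ) h = conv μ ν hν + conv μ ρ hρ := by
  ext B hB : 1
  rw [_root_.add_apply, conv_apply _ _ _ hB, conv_apply _ _ _ hB, conv_apply _ _ _ hB]
  exact integral_fun_add (integrable_translate μ hν hB) (integrable_translate μ hρ hB)

theorem add_conv (μ ν ρ : ComplexMeasure G) (h : ρ.variation.Regular) :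
    conv (μ + ν) ρ h = conv μ ρ h + conv ν ρ h := by
  ext B hB : 1
  rw [_root_.add_apply, conv_apply _ _ _ hB, conv_apply _ _ _ hB, conv_apply _ _ _ hB]
  exact integral_add_vectorMeasure (integrable_translate μ h hB) (integrable_translate ν h hB)

theorem smul_conv (c : ℂ) (μ ν : ComplexMeasure G) (h : ν.variation.Regular) :
    conv (c • μ) ν h = c • conv μ ν h := by
  ext B hB : 1
  rw [_root_.smul_apply, conv_apply _ _ _ hB, conv_apply _ _ _ hB]
  exact cint_smul_measure c μ (measurable_translate_complex h hB) fun _ => norm_apply_le_bound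

theorem conv_smul (c : ℂ) (μ ν : ComplexMeasure G) (h : ν.variation.Regular)
    (h' : (c • ν).variation.Regular) : conv μ (c • ν) h' = c • conv μ ν h := by
  ext B hB : 1
  rw [_root_.smul_apply, conv_apply _ _ _ hB, conv_apply _ _ _ hB]
  exact cint_const_mul μ c (integrable_translate μ h hB)

theorem zero_conv (ν : ComplexMeasure G) (h : ν.variation.Regular) : conv 0 ν h = 0 := by
  ext B hB : 1
  rw [conv_apply _ _ _ hB]
  exact integral_zero_vectorMeasure

theorem conv_zero (μ : ComplexMeasure G) (h : (0 : ComplexMeasure G).variation.Regular) :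
    conv μ 0 h = 0 := by
  ext B hB : 1
  rw [conv_apply _ _ _ hB]
  exact VectorMeasure.integral_zero

/-- Integration against a convolution. -/
theorem cint_conv (μ ν : ComplexMeasure G) (hν : ν.variation.Regular) {f : G → ℂ}
    (hf : Measurable f) {b : ℝ} (hb : ∀ x, ‖f x‖ ≤ b) :
    Measurable (fun x => cint ν fun y => f (x * y)) ∧
      cint (conv μ ν hν) f = cint μ fun x => cint ν fun y => f (x * y) := by
  have hm : ∀ x : G, Measurable (x * · : G → G) := fun x => (continuous_const_mul x).measurable
  refine bounded_induction (P := fun f => Measurable (fun x => cint ν fun y => f (x * y)) ∧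
      cint (conv μ ν hν) f = cint μ fun x => cint ν fun y => f (x * y)) ?_ ?_ ?_ hf hb
  · intro c B hB
    have h : ∀ x, cint ν (fun y => B.indicator (fun _ => c) (x * y)) = c * ν ((x * ·) ⁻¹' B) :=
      fun x => cint_indicator_const ν (hm x hB) c
    simp only [h]
    refine ⟨(measurable_translate_complex hν hB).const_mul c, ?_⟩
    rw [cint_indicator_const _ hB, conv_apply _ _ _ hB,
      cint_const_mul _ _ (integrable_translate μ hν hB)]
  · rintro f g b hf hg hfb hgb ⟨h1, h2⟩ ⟨h3, h4⟩
    have h : ∀ x, cint ν (fun y => f (x * y) + g (x * y)) =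
        cint ν (fun y => f (x * y)) + cint ν (fun y => g (x * y)) := fun x =>
      cint_add ν (integrable_of_bounded ν (hf.comp (hm x)) fun y => hfb (x * y))
        (integrable_of_bounded ν (hg.comp (hm x)) fun y => hgb (x * y))
    simp only [h]
    refine ⟨h1.add h3, ?_⟩
    rw [cint_add _ (integrable_of_bounded _ hf hfb) (integrable_of_bounded _ hg hgb), h2, h4,
      cint_add _ (integrable_of_bounded _ h1 fun x => norm_cint_le ν fun y => hfb (x * y))
      (integrable_of_bounded _ h3 fun x => norm_cint_le ν fun y => hgb (x * y))]
  · intro F f b hF hb h hP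
    have ht : ∀ x, Tendsto (fun n => cint ν fun y => F n (x * y)) atTop
        (𝓝 (cint ν fun y => f (x * y))) := fun x =>
      tendsto_cint ν (fun n => (hF n).comp (hm x)) (fun n y => hb n (x * y)) fun y => h (x * y)
    refine ⟨measurable_of_tendsto_metrizable (fun n => (hP n).1) (tendsto_pi_nhds.2 ht), ?_⟩
    refine tendsto_nhds_unique (tendsto_cint _ hF hb h) ?_
    simp only [fun n => (hP n).2]
    exact tendsto_cint μ (fun n => (hP n).1) (fun n x => norm_cint_le ν fun y => hb n (x * y)) ht

theorem conv_assoc (μ ν ρ : ComplexMeasure G) (hν : ν.variation.Regular)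
    (hρ : ρ.variation.Regular) :
    conv (conv μ ν hν) ρ hρ = conv μ (conv ν ρ hρ) (regular_conv hν hρ) := by
  ext B hB : 1
  rw [conv_apply _ _ _ hB, conv_apply _ _ _ hB,
    (cint_conv μ ν hν (measurable_translate_complex hρ hB) fun _ => norm_apply_le_bound).2]
  congr 1
  funext x
  rw [conv_apply _ _ _ ((continuous_const_mul x).measurable hB)]
  simp only [preimage_preimage, mul_assoc]

theorem regular_dirac (x : G) (c : ℂ) : (VectorMeasure.dirac x c).variation.Regular := by
  have : (VectorMeasure.dirac x c).variation = ‖c‖₊ • Measure.dirac x := variation_dirac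
  have hd : (Measure.dirac x).InnerRegular := by
    refine ⟨fun U hU r hr => ⟨{x}, ?_, isCompact_singleton, ?_⟩⟩ <;>
    · by_cases hx : x ∈ U
      · simpa [hx] using hr
      · simp [Measure.dirac_apply' x hU, hx] at hr
  rw [this]
  infer_instance

theorem dirac_conv (ν : ComplexMeasure G) (h : ν.variation.Regular) :
    conv (VectorMeasure.dirac 1 1) ν h = ν := by
  ext B hB : 1
  rw [conv_apply _ _ _ hB, cint, VectorMeasure.integral_dirac]
  simp

theorem conv_dirac (μ : ComplexMeasure G) :
    conv μ (VectorMeasure.dirac 1 1) (regular_dirac 1 1) = μ := by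
  ext B hB : 1
  have h : (fun x : G => VectorMeasure.dirac (1 : G) (1 : ℂ) ((x * ·) ⁻¹' B)) =
      B.indicator fun _ => 1 := by
    funext x
    have hm : MeasurableSet ((x * ·) ⁻¹' B) := (continuous_const_mul x).measurable hB
    by_cases hx : x ∈ B
    · rw [dirac_apply_of_mem hm (by simpa using hx), indicator_of_mem hx]
    · rw [dirac_apply_of_notMem (by simpa using hx), indicator_of_notMem hx]
  rw [conv_apply _ _ _ hB, h, cint_indicator_const _ hB, one_mul]

end Complex

/-! ### The weighted measure algebra -/

section Weighted

/-- A weight on a locally compact group: a Borel function `ω : G → [1, ∞)`, bounded on compact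
sets, with `ω(1) = 1` and `ω(uv) ≤ ω(u) ω(v)`. -/
structure Weight (G : Type*) [Group G] [TopologicalSpace G] [MeasurableSpace G] where
  toFun : G → ℝ
  measurable : Measurable toFun
  one_le : ∀ u, 1 ≤ toFun u
  map_one : toFun 1 = 1
  map_mul_le : ∀ u v, toFun (u * v) ≤ toFun u * toFun v
  bddAbove_image : ∀ K : Set G, IsCompact K → BddAbove (toFun '' K)

variable {G : Type*} [Group G] [TopologicalSpace G] [IsTopologicalGroup G]
  [LocallyCompactSpace G] [T2Space G] [MeasurableSpace G] [BorelSpace G]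

/-- The weighted norm `‖μ‖_ω = ∫ ω d|μ|`, with values in `[0, ∞]`. -/
noncomputable def Weight.norm (ω : Weight G) (μ : ComplexMeasure G) : ℝ≥0∞ :=
  ∫⁻ t, ENNReal.ofReal (ω.toFun t) ∂μ.variation

/-- The space `M(G, ω)` of regular complex Borel measures `μ` on `G` with `∫ ω d|μ| < ∞`. -/
noncomputable def weightedMeasures (ω : Weight G) : Submodule ℂ (ComplexMeasure G) where
  carrier := {μ | μ.variation.Regular ∧ ω.norm μ < ∞}
  zero_mem' := by
    rw [Set.mem_ofPred_eq, Weight.norm, variation_zero]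
    exact ⟨inferInstance, by simp⟩
  add_mem' := by
    rintro μ ν ⟨hμ, hμω⟩ ⟨hν, hνω⟩
    have := isFiniteMeasure_variation μ
    have := innerRegular_variation hμ
    have := isFiniteMeasure_variation ν
    have := innerRegular_variation hν
    refine ⟨regular_of_le variation_add_le, ?_⟩
    refine (lintegral_mono' variation_add_le le_rfl).trans_lt ?_
    rw [lintegral_add_measure]
    exact ENNReal.add_lt_top.2 ⟨hμω, hνω⟩
  smul_mem' := by
    rintro c μ ⟨hμ, hμω⟩
    have hs : (c • μ).variation = ‖c‖₊ • μ.variation := variation_smul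
    refine ⟨by rw [hs]; infer_instance, ?_⟩
    rw [Weight.norm, hs, lintegral_smul_measure]
    exact ENNReal.mul_lt_top ENNReal.coe_lt_top hμω

theorem conv_mem (ω : Weight G) {μ ν : ComplexMeasure G} (hμ : μ ∈ weightedMeasures ω)
    (hν : ν ∈ weightedMeasures ω) : conv μ ν hν.1 ∈ weightedMeasures ω := by
  have := isFiniteMeasure_variation ν
  have := innerRegular_variation hν.1
  refine ⟨regular_conv hμ.1 hν.1, ?_⟩
  have hω : Measurable fun t => ENNReal.ofReal (ω.toFun t) := ω.measurable.ennreal_ofReal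
  calc ω.norm (conv μ ν hν.1)
      ≤ ∫⁻ t, ENNReal.ofReal (ω.toFun t) ∂posConv μ.variation ν.variation :=
        lintegral_mono' (variation_conv_le μ ν hν.1) le_rfl
    _ = ∫⁻ x, ∫⁻ y, ENNReal.ofReal (ω.toFun (x * y)) ∂ν.variation ∂μ.variation :=
        lintegral_posConv _ _ hω
    _ ≤ ∫⁻ x, ∫⁻ y, ENNReal.ofReal (ω.toFun x) * ENNReal.ofReal (ω.toFun y)
          ∂ν.variation ∂μ.variation := by
        refine lintegral_mono fun x => lintegral_mono fun y => ?_
        rw [← ENNReal.ofReal_mul (zero_le_one.trans (ω.one_le x))]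
        exact ENNReal.ofReal_le_ofReal (ω.map_mul_le x y)
    _ = ω.norm μ * ω.norm ν := by
        simp only [lintegral_const_mul _ hω, lintegral_mul_const _ hω, Weight.norm]
    _ < ∞ := ENNReal.mul_lt_top hμ.2 hν.2

theorem dirac_mem (ω : Weight G) : VectorMeasure.dirac 1 1 ∈ weightedMeasures ω := by
  refine ⟨regular_dirac 1 1, ?_⟩
  have : (VectorMeasure.dirac (1 : G) (1 : ℂ)).variation = ‖(1 : ℂ)‖₊ • Measure.dirac 1 :=
    variation_dirac
  rw [Weight.norm, this]
  simp

/-- The weighted measure algebra `M(G, ω)`. -/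
def MeasureAlgebra (ω : Weight G) : Type _ := weightedMeasures ω

namespace MeasureAlgebra

variable {ω : Weight G}

noncomputable instance : AddCommGroup (MeasureAlgebra ω) :=
  inferInstanceAs (AddCommGroup (weightedMeasures ω))

noncomputable instance : Module ℂ (MeasureAlgebra ω) :=
  inferInstanceAs (Module ℂ (weightedMeasures ω))

/-- The product of `M(G, ω)` is convolution. -/
noncomputable instance : Mul (MeasureAlgebra ω) :=
  ⟨fun μ ν => ⟨conv μ.1 ν.1 ν.2.1, conv_mem ω μ.2 ν.2⟩⟩

/-- The identity of `M(G, ω)` is the point mass at the identity of `G`. -/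
noncomputable instance : One (MeasureAlgebra ω) := ⟨⟨VectorMeasure.dirac 1 1, dirac_mem ω⟩⟩

noncomputable instance : Ring (MeasureAlgebra ω) where
  __ := (inferInstance : AddCommGroup (MeasureAlgebra ω))
  mul := (· * ·)
  one := 1
  left_distrib μ ν ρ := Subtype.ext (conv_add μ.1 ν.1 ρ.1 ν.2.1 ρ.2.1 (ν + ρ).2.1)
  right_distrib μ ν ρ := Subtype.ext (add_conv μ.1 ν.1 ρ.1 ρ.2.1)
  zero_mul μ := Subtype.ext (zero_conv μ.1 μ.2.1)
  mul_zero μ := Subtype.ext (conv_zero μ.1 (0 : MeasureAlgebra ω).2.1)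
  mul_assoc μ ν ρ := Subtype.ext (conv_assoc μ.1 ν.1 ρ.1 ν.2.1 ρ.2.1)
  one_mul μ := Subtype.ext (dirac_conv μ.1 μ.2.1)
  mul_one μ := Subtype.ext (conv_dirac μ.1)

noncomputable instance : Algebra ℂ (MeasureAlgebra ω) :=
  Algebra.ofModule
    (fun c μ ν => Subtype.ext (smul_conv c μ.1 ν.1 ν.2.1))
    (fun c μ ν => Subtype.ext (conv_smul c μ.1 ν.1 ν.2.1 (c • ν).2.1))

end MeasureAlgebra

end Weighted

/-- The assertion of the Dales–Żelazko conjecture for a unital complex algebra `A`: if every maximal left ideal of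
`A` is finitely generated as a left ideal, then `A` is finite-dimensional. In Mathlib, `Ideal A` is
the type of left ideals of the ring `A`. -/
def DalesZelazko (A : Type*) [Ring A] [Algebra ℂ A] : Prop :=
  (∀ I : Ideal A, I.IsMaximal → I.FG) → FiniteDimensional ℂ A

end MeasAlg

/-! One maximal left ideal is enough: its finite generation forces `G` to be countable, and a
countable locally compact Hausdorff group is discrete by Baire.

A complex measure has finite total variation, hence countably many atoms, and its values on
countable sets come from those atoms alone. The total mass of the atomic part is multiplicative for
convolution, and its kernel `atomicAugmentation ω` has codimension one, so it is a maximal left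
ideal. It contains every difference of two point masses.

Suppose finitely many measures generate this ideal. Their atoms together generate a countable
subgroup `H`. Each generator has atomic mass zero and all its atoms in `H`, so it vanishes on `H`
and, having no atoms there, on every other left coset of `H`. Vanishing on all left cosets of `H`
defines a left ideal, `cosetNull`, which therefore contains the whole of `atomicAugmentation ω`. If
some `g` lay outside `H`, the difference of the point masses at `1` and `g` would take the value 1
on `H`, a contradiction. Hence `G = H` is countable.

Both left ideals rest on `conv_apply_eq_zero`: on a countable set, a convolution sees only the atoms
of its left factor. -/

namespace MeasAlg

open MeasureTheory MeasureTheory.VectorMeasure Set Filter Topology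
open scoped ENNReal NNReal Pointwise

/-! ### Atoms of complex measures -/

section Atoms

variable {X : Type*} [MeasurableSpace X]

/-- The atoms of a complex measure. -/
def atoms (μ : ComplexMeasure X) : Set X := {x | 0 < μ.variation {x}}

theorem variation_eq_zero_of_disjoint_atoms (μ : ComplexMeasure X) {D : Set X}
    (hD : D.Countable) (h : Disjoint D (atoms μ)) : μ.variation D = 0 := by
  rw [← biUnion_of_singleton D]
  refine (measure_biUnion_null_iff hD).2 fun x hx => ?_
  by_contra h0
  exact disjoint_left.1 h hx (pos_iff_ne_zero.2 h0)

variable [MeasurableSingletonClass X]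

/-- The singletons are disjoint and the variation is finite, so only countably many of them can have
positive mass. -/
theorem countable_atoms (μ : ComplexMeasure X) : (atoms μ).Countable := by
  have := isFiniteMeasure_variation μ
  exact Measure.countable_meas_pos_of_disjoint_iUnion (fun x => measurableSet_singleton x)
    fun x y hxy => disjoint_singleton.2 hxy

theorem apply_eq_zero_of_disjoint_atoms (μ : ComplexMeasure X) {D : Set X}
    (hD : D.Countable) (h : Disjoint D (atoms μ)) : μ D = 0 :=
  (variation_apply_eq_zero hD.measurableSet).1 (variation_eq_zero_of_disjoint_atoms μ hD h)
    D Subset.rfl hD.measurableSet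

/-- The remainder `D \ atoms μ` is countable and atom-free, hence null. The common value `μ (atoms
μ)` is the total mass of the atomic part, available without decomposing `μ`. -/
theorem apply_eq_apply_atoms (μ : ComplexMeasure X) {D : Set X} (hD : D.Countable)
    (h : atoms μ ⊆ D) : μ D = μ (atoms μ) := by
  have h1 := of_union (v := μ) (disjoint_sdiff_right (s := atoms μ) (t := D))
    (countable_atoms μ).measurableSet (hD.mono sdiff_subset).measurableSet
  rw [union_sdiff_cancel h, apply_eq_zero_of_disjoint_atoms μ (hD.mono sdiff_subset)
    disjoint_sdiff_left, add_zero] at h1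
  exact h1

end Atoms

/-! ### Countable subgroups and countable locally compact groups -/

theorem countable_closure {G : Type*} [Group G] {S : Set G} (hS : S.Countable) :
    (Subgroup.closure S : Set G).Countable := by
  have := hS.to_subtype
  -- The free group is a quotient of the lists over `S × Bool`, and the closure of `S` is its image.
  have : Countable (FreeGroup S) := by unfold FreeGroup; infer_instance
  rw [FreeGroup.closure_eq_range, MonoidHom.coe_range]
  exact countable_range _

variable {G : Type*} [Group G] [TopologicalSpace G] [IsTopologicalGroup G]
  [LocallyCompactSpace G] [T2Space G]

/-- A countable locally compact Hausdorff group is discrete. -/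
theorem discreteTopology_of_countable [Countable G] : DiscreteTopology G := by
  -- Baire category: countably many closed singletons cover `G`, so one of them has an interior
  -- point. Translation then makes `{1}` open.
  obtain ⟨x, y, hy⟩ := nonempty_interior_of_iUnion_of_closed (f := fun x : G => {x})
    (fun x => isClosed_singleton) (iUnion_of_singleton G)
  have hx : IsOpen ({x} : Set G) := by
    have hyx : y = x := interior_subset (s := {x}) hy
    rw [← interior_eq_iff_isOpen]
    exact interior_subset.antisymm (singleton_subset_iff.2 (hyx ▸ hy))
  refine discreteTopology_of_isOpen_singleton_one ?_
  simpa using hx.preimage (continuous_const_mul x)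

variable [MeasurableSpace G] [BorelSpace G]

/-! ### Convolutions on countable sets -/

/-- If `ν` vanishes on the translates of `D` by the atoms of `μ`, then `μ * ν` vanishes on `D`. -/
theorem conv_apply_eq_zero (μ ν : ComplexMeasure G) (hν : ν.variation.Regular) {D : Set G}
    (hD : D.Countable) (h : ∀ x ∈ atoms μ, ν ((x * ·) ⁻¹' D) = 0) : conv μ ν hν D = 0 := by
  rw [conv_apply _ _ _ hD.measurableSet, cint]
  refine integral_eq_zero_of_ae ?_
  -- The set `x⁻¹D` meets `atoms ν` only for `x` in `D / atoms ν`, and `h` disposes of the atoms of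
  -- `μ`. The integrand is thus supported in this countable set, which is free of atoms of `μ` and
  -- hence null.
  have hE : ((D / atoms ν) \ atoms μ).Countable :=
    (hD.image2 (countable_atoms ν) (· / ·)).mono sdiff_subset
  refine measure_mono_null (fun x hx => ?_)
    (variation_eq_zero_of_disjoint_atoms μ hE disjoint_sdiff_left)
  by_contra hx'
  refine hx (by_contra fun h0 => ?_)
  refine h0 (apply_eq_zero_of_disjoint_atoms ν (hD.preimage (mul_right_injective x)) ?_)
  refine disjoint_left.2 fun y hy hyν => hx' ⟨⟨x * y, hy, y, hyν, mul_div_cancel_right x y⟩, ?_⟩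
  exact fun hxμ => h0 (h x hxμ)

/-! ### The maximal left ideal of measures with zero atomic mass -/

namespace MeasureAlgebra

variable (ω : Weight G)

theorem dirac_mem_weightedMeasures (g : G) :
    VectorMeasure.dirac g (1 : ℂ) ∈ weightedMeasures ω := by
  refine ⟨regular_dirac g 1, ?_⟩
  have : (VectorMeasure.dirac g (1 : ℂ)).variation = ‖(1 : ℂ)‖₊ • Measure.dirac g :=
    variation_dirac
  rw [Weight.norm, this]
  simp

/-- The point mass at `g` as an element of `M(G, ω)`. -/
noncomputable def pointMass (g : G) : MeasureAlgebra ω :=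
  ⟨VectorMeasure.dirac g 1, dirac_mem_weightedMeasures ω g⟩

/-- The left ideal of the measures whose atomic part has total mass zero. -/
def atomicAugmentation : Ideal (MeasureAlgebra ω) where
  -- Asking for vanishing on all large countable sets, rather than on `atoms μ`, leaves `C` free to
  -- grow, so sums and products need no computation of their atoms.
  carrier := {μ | ∃ C : Set G, C.Countable ∧ ∀ D, D.Countable → C ⊆ D → μ.1 D = 0}
  zero_mem' := ⟨∅, countable_empty, fun _ _ _ => rfl⟩
  add_mem' := by
    rintro μ ν ⟨C, hC, hμ⟩ ⟨C', hC', hν⟩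
    refine ⟨C ∪ C', hC.union hC', fun D hD h => ?_⟩
    change μ.1 D + ν.1 D = 0
    rw [hμ D hD (subset_union_left.trans h), hν D hD (subset_union_right.trans h), add_zero]
  smul_mem' := by
    rintro μ ν ⟨C, hC, hν⟩
    -- If `D` contains `atoms μ * C`, then `x⁻¹D` contains `C` for every atom `x` of `μ`, so `ν`
    -- vanishes on it.
    refine ⟨atoms μ.1 * C, (countable_atoms μ.1).image2 hC (· * ·), fun D hD h => ?_⟩
    refine conv_apply_eq_zero μ.1 ν.1 ν.2.1 hD fun x hx => ?_
    exact hν _ (hD.preimage (mul_right_injective x)) fun c hc => h (mul_mem_mul hx hc)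

variable {ω}

/-- All countable sets containing the atoms have the same measure, so `D` may be enlarged to `D ∪
C`, where the defining condition applies. -/
theorem apply_eq_zero_of_mem_atomicAugmentation {μ : MeasureAlgebra ω}
    (hμ : μ ∈ atomicAugmentation ω) {D : Set G} (hD : D.Countable) (h : atoms μ.1 ⊆ D) :
    μ.1 D = 0 := by
  obtain ⟨C, hC, hC0⟩ := hμ
  rw [apply_eq_apply_atoms _ hD h, ← apply_eq_apply_atoms _ (hD.union hC)
    (h.trans subset_union_left)]
  exact hC0 _ (hD.union hC) subset_union_right

/-- Subtracting the atomic mass times the identity cancels it. This shows that the ideal and the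
scalars span the algebra. -/
theorem sub_smul_one_mem_atomicAugmentation (μ : MeasureAlgebra ω) :
    μ - μ.1 (atoms μ.1) • (1 : MeasureAlgebra ω) ∈ atomicAugmentation ω := by
  refine ⟨insert 1 (atoms μ.1), (countable_atoms μ.1).insert 1, fun D hD h => ?_⟩
  change μ.1 D - μ.1 (atoms μ.1) * VectorMeasure.dirac (1 : G) (1 : ℂ) D = 0
  rw [dirac_apply_of_mem hD.measurableSet (h (mem_insert _ _)), mul_one,
    apply_eq_apply_atoms _ hD ((subset_insert _ _).trans h), sub_self]

variable (ω)

/-- The identity has atomic mass 1, so the ideal is proper. Modulo the ideal, a measure outside it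
is a nonzero multiple of the identity, so any larger left ideal containing that measure contains the
identity. -/
theorem isMaximal_atomicAugmentation : (atomicAugmentation ω).IsMaximal := by
  refine Ideal.isMaximal_iff.2 ⟨?_, fun J μ hJ hμ hμJ => ?_⟩
  · rintro ⟨C, hC, h⟩
    have h1 := h (insert 1 C) (hC.insert 1) (subset_insert _ _)
    change VectorMeasure.dirac (1 : G) (1 : ℂ) (insert 1 C) = 0 at h1
    rw [dirac_apply_of_mem (hC.insert 1).measurableSet (mem_insert _ _)] at h1
    exact one_ne_zero h1
  · have h1 := sub_smul_one_mem_atomicAugmentation μ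
    set c := μ.1 (atoms μ.1)
    have hc : c ≠ 0 := by
      intro hc
      rw [hc, zero_smul, sub_zero] at h1
      exact hμ h1
    have h2 : c • (1 : MeasureAlgebra ω) ∈ J := by
      simpa using J.sub_mem hμJ (hJ h1)
    have h3 := J.mul_mem_left (c⁻¹ • (1 : MeasureAlgebra ω)) h2
    rwa [smul_mul_smul_comm, inv_mul_cancel₀ hc, one_smul, one_mul] at h3

theorem pointMass_sub_pointMass_mem (g h : G) :
    pointMass ω g - pointMass ω h ∈ atomicAugmentation ω := by
  refine ⟨{g, h}, (countable_singleton h).insert g, fun D hD hgh => ?_⟩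
  change VectorMeasure.dirac g (1 : ℂ) D - VectorMeasure.dirac h (1 : ℂ) D = 0
  rw [dirac_apply_of_mem hD.measurableSet (hgh (by simp)),
    dirac_apply_of_mem hD.measurableSet (hgh (by simp)), sub_self]

/-! ### Vanishing on cosets, and countability of the group -/

/-- The left ideal of the measures that vanish on all left cosets of a countable subgroup. -/
def cosetNull (H : Subgroup G) (hH : (H : Set G).Countable) : Ideal (MeasureAlgebra ω) where
  -- The preimage is the left coset `g⁻¹H`. Left translation permutes these cosets, which gives
  -- stability under left multiplication.
  carrier := {μ | ∀ g : G, μ.1 ((g * ·) ⁻¹' H) = 0}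
  zero_mem' _ := rfl
  add_mem' {μ ν} hμ hν g := by
    change μ.1 _ + ν.1 _ = 0
    rw [hμ g, hν g, add_zero]
  smul_mem' μ ν hν g := by
    refine conv_apply_eq_zero μ.1 ν.1 ν.2.1 (hH.preimage (mul_right_injective g)) fun x _ => ?_
    simpa only [preimage_preimage, mul_assoc] using hν (g * x)

variable {ω}

/-- The coset `H` carries all the atoms, whose total mass is zero; every other left coset is
countable and contains none. -/
theorem mem_cosetNull_of_atoms_subset {H : Subgroup G} (hH : (H : Set G).Countable)
    {μ : MeasureAlgebra ω} (hμ : μ ∈ atomicAugmentation ω) (h : atoms μ.1 ⊆ H) :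
    μ ∈ cosetNull ω H hH := by
  intro g
  have hc : ((g * ·) ⁻¹' (H : Set G)).Countable := hH.preimage (mul_right_injective g)
  by_cases hg : g ∈ H
  · exact apply_eq_zero_of_mem_atomicAugmentation hμ hc fun x hx => H.mul_mem hg (h hx)
  · refine apply_eq_zero_of_disjoint_atoms _ hc (disjoint_left.2 fun x hx hxμ => hg ?_)
    exact (H.mul_mem_cancel_right (h hxμ)).1 hx

variable (ω)

/-- If the maximal left ideal `atomicAugmentation ω` is finitely generated, then `G` is countable. -/
theorem countable_of_fg_atomicAugmentation (h : (atomicAugmentation ω).FG) : Countable G := by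
  obtain ⟨S, hS⟩ := h
  have hA : (⋃ μ ∈ S, atoms μ.1).Countable :=
    S.countable_toSet.biUnion fun μ _ => countable_atoms μ.1
  have hH := countable_closure hA
  set H := Subgroup.closure (⋃ μ ∈ S, atoms μ.1)
  -- Only the finitely many generators need checking, because `cosetNull` is itself a left ideal.
  have hle : atomicAugmentation ω ≤ cosetNull ω H hH := by
    conv_lhs => rw [← hS]
    refine Ideal.span_le.2 fun μ hμ => mem_cosetNull_of_atoms_subset hH ?_ ?_
    · rw [← hS]
      exact Ideal.subset_span hμ
    · exact (subset_biUnion_of_mem (u := fun μ : MeasureAlgebra ω => atoms μ.1) hμ).trans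
        Subgroup.subset_closure
  have htop : ∀ g, g ∈ H := by
    intro g
    by_contra hg
    -- Evaluation on the coset `H` itself: the point mass at `1` gives 1, and the one at `g ∉ H`
    -- gives 0.
    have h1 := hle (pointMass_sub_pointMass_mem ω 1 g) 1
    change VectorMeasure.dirac (1 : G) (1 : ℂ) ((1 * ·) ⁻¹' (H : Set G)) -
      VectorMeasure.dirac g (1 : ℂ) ((1 * ·) ⁻¹' (H : Set G)) = 0 at h1
    simp only [one_mul, preimage_id'] at h1
    rw [dirac_apply_of_mem hH.measurableSet H.one_mem, dirac_apply_of_notMem hg, sub_zero] at h1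
    exact one_ne_zero h1
  rw [← countable_univ_iff]
  exact hH.mono fun g _ => htop g

end MeasureAlgebra

end MeasAlg

theorem theorem3p6 {G : Type*} [Group G] [TopologicalSpace G] [IsTopologicalGroup G]
    [LocallyCompactSpace G] [T2Space G] [MeasurableSpace G] [BorelSpace G]
    (hG : ¬ DiscreteTopology G) (ω : MeasAlg.Weight G) :
    MeasAlg.DalesZelazko (MeasAlg.MeasureAlgebra ω) := by
  intro h
  have := MeasAlg.MeasureAlgebra.countable_of_fg_atomicAugmentation ω
    (h _ (MeasAlg.MeasureAlgebra.isMaximal_atomicAugmentation ω))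
  exact absurd MeasAlg.discreteTopology_of_countable hG
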